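/- Let $A$ be an operator algebra (a norm closed, possibly nonselfadjoint, algebra of operators on a Hilbert space) which is approximately unital, i.e. has a contractive approximate identity (cai). Let $C$ be any $C^*$-algebra generated by $A$. For an algebra $D$ ($D=A$ or $D=C$), call $D$ unital if it has an identity of norm $1$; write $D^1=D$ if $D$ is unital, and otherwise let $D^1=D+\mathbb{C}1$ be the unitization. Let $B=C^1$, a $C^*$-algebra containing $A^1$ as a subalgebra with the same identity, and regard $B$ as a subalgebra of its second dual $B^{**}$, which carries the Arens product (so it is a von Neumann algebra). Let $e\in (A^1)^{**}\subseteq B^{**}$ be the weak* limit of the cai of $A$, and let $q=1-e$. (i) If $q\le d$ in $B^{**}$ for an invertible element $d$ of the positive cone $B_+$, then there exists $g\in A^1$ with $gq=qg=q$ and $g^*g\le d$. (ii) Consequently, if $A$ is nonunital and $c\in C_+$ with $\|c\|<1$, then there exists $a\in A$ with $|1+a|^2\le 1-c$, where $|x|^2=x^*x$. -/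

import Mathlib

open Filter Topology
open scoped ComplexOrder

namespace OperatorAlgebra

section Bidual

variable (B : Type*) [NonUnitalNormedRing B] [NormedSpace ℂ B] [IsScalarTower ℂ B B]
  [SMulCommClass ℂ B B]

/-- The second dual `B**` of a complex normed algebra `B`. -/
abbrev Bidual : Type _ := StrongDual ℂ (StrongDual ℂ B)

variable {B}

/-- The canonical embedding of `B` into its second dual: `b ↦ (φ ↦ φ b)`. -/
noncomputable abbrev incl : B →L[ℂ] Bidual B := NormedSpace.inclusionInDoubleDual ℂ B

/-- The functional `φ · b : c ↦ φ (b * c)`. -/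
noncomputable def dualMul (φ : StrongDual ℂ B) : B →L[ℂ] StrongDual ℂ B :=
  (ContinuousLinearMap.compL ℂ B B ℂ φ) ∘L (ContinuousLinearMap.mul ℂ B)

/-- The functional `G · φ : b ↦ G (φ · b)`, as a continuous linear function of `φ`. -/
noncomputable def bidualMul (G : Bidual B) : StrongDual ℂ B →L[ℂ] StrongDual ℂ B :=
  (ContinuousLinearMap.compL ℂ B (StrongDual ℂ B) ℂ G) ∘L
    ((ContinuousLinearMap.compL ℂ B (B →L[ℂ] B) (StrongDual ℂ B)).flip
      (ContinuousLinearMap.mul ℂ B)) ∘L (ContinuousLinearMap.compL ℂ B B ℂ)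

/-- The (first) Arens product on `B**`: `(F G)(φ) = F (b ↦ G (c ↦ φ (b * c)))`. If `B` is a
C*-algebra this is the product of the von Neumann algebra `B**`. -/
noncomputable def arens (F G : Bidual B) : Bidual B := F ∘L bidualMul G

theorem dualMul_apply (φ : StrongDual ℂ B) (b c : B) : dualMul φ b c = φ (b * c) := rfl

theorem bidualMul_apply (G : Bidual B) (φ : StrongDual ℂ B) (b : B) :
    bidualMul G φ b = G (dualMul φ b) := rfl

theorem arens_apply (F G : Bidual B) (φ : StrongDual ℂ B) :
    arens F G φ = F (bidualMul G φ) := rfl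

/-- The order of the von Neumann algebra `B**` of a C*-algebra `B`: `F ≤ G` if and only if
`F φ ≤ G φ` for every positive functional `φ` on `B` (these are the normal positive functionals
of `B**`). The inequality in `ℂ` means that `G φ - F φ` is real and nonnegative. -/
def BidualLE [PartialOrder B] (F G : Bidual B) : Prop :=
  ∀ φ : StrongDual ℂ B, (∀ b : B, 0 ≤ b → 0 ≤ φ b) → F φ ≤ G φ

end Bidual

section Algebras

variable {B : Type*} [CStarAlgebra B]

/-- `u` is an identity of norm `1` of the set `S` (with the multiplication of `B`). -/
def IsIdentityOf (S : Set B) (u : B) : Prop :=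
  u ∈ S ∧ ‖u‖ = 1 ∧ ∀ a ∈ S, u * a = a ∧ a * u = a

/-- An algebra (as a subset of `B`) is unital if it has an identity of norm `1`. -/
def IsUnital (S : Set B) : Prop := ∃ u : B, IsIdentityOf S u

/-- The C*-subalgebra `C` of `B` generated by `A`. -/
noncomputable def generatedCStar (A : NonUnitalSubalgebra ℂ B) : NonUnitalStarSubalgebra ℂ B :=
  (NonUnitalStarAlgebra.adjoin ℂ (A : Set B)).topologicalClosure

/-- The C*-algebra `B` is the unitization `C¹` of its C*-subalgebra `C`: `B = C + ℂ 1`, and if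
`C` is unital, then its identity is that of `B` (in other words, `B = C` in that case). -/
structure IsUnitizationOf (C : NonUnitalStarSubalgebra ℂ B) : Prop where
  exists_eq : ∀ b : B, ∃ z : ℂ, ∃ c ∈ C, b = z • (1 : B) + c
  eq_one : ∀ u : B, IsIdentityOf (C : Set B) u → u = 1

/-- The unitization `A¹ = A + ℂ 1` inside `B`. It is `A` itself if `1 ∈ A`. -/
def unitization (A : NonUnitalSubalgebra ℂ B) : Set B :=
  {x | ∃ z : ℂ, ∃ a ∈ A, x = z • (1 : B) + a}

/-- The net `u` is a contractive approximate identity of `A`. -/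
structure IsCai {ι : Type*} [Preorder ι] (A : NonUnitalSubalgebra ℂ B) (u : ι → B) : Prop where
  mem : ∀ i, u i ∈ A
  norm_le : ∀ i, ‖u i‖ ≤ 1
  left : ∀ a ∈ A, Tendsto (fun i => u i * a) atTop (𝓝 a)
  right : ∀ a ∈ A, Tendsto (fun i => a * u i) atTop (𝓝 a)

/-- `e ∈ B**` is the weak* limit of the net `u` in `B`. -/
def IsWeakStarLimit {ι : Type*} [Preorder ι] (u : ι → B) (e : Bidual B) : Prop :=
  Tendsto (fun i => StrongDual.toWeakDual (incl (u i))) atTop (𝓝 (StrongDual.toWeakDual e))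

end Algebras

end OperatorAlgebra

namespace OperatorAlgebra

/-! ### The C*-algebra generated by `A` -/

section Generated

variable {B : Type*} [CStarAlgebra B]

/-! If `1 ∈ C`, the cai converges to `1`, so `1 ∈ A` and `g = 0` works. Otherwise `C` is a closed
ideal of codimension one in `B`, and the quotient character `χ` kills the cai. Testing `q ≤ d` on
`χ` shows that `d = r • 1 + c` with `c ∈ C` and `1 ≤ r`. Hence `f = d^(-1/2)` equals `lam • 1 + k`
with `k ∈ C` and `lam = r^(-1/2) ≤ 1`.

It suffices to find `a ∈ A` with `‖(1 + a) f‖ ≤ 1`: conjugating by `d^(1/2)` gives `(1 + a)* (1 + a)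
≤ d`. Any such `g = 1 + a` fixes `q`, because `A` annihilates `q`. The element `g` is the sum of a
peak interpolation series `∑ 2^(-n) (1 - v n)` with contractions `v n ∈ A` (`IsCai.exists_seq`).
Each `v n` is close to a positive contraction `w` nearly fixing the part of the partial sum times
`f` that lies in `C` (`IsCai.exists_nearly_positive`). That part and `1 - w` barely overlap, so the
norm grows only as the scalar part does (`norm_add_smul_one_sub_sq_le`). Part (ii) is the case `d =
1 - c`, `r = 1`. -/

theorem isClosed_setOf_tendsto_mul {ι : Type*} {l : Filter ι} {u : ι → B}
    (hu : ∀ i, ‖u i‖ ≤ 1) : IsClosed {x : B | Tendsto (fun i => u i * x) l (𝓝 x)} := by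
  refine isClosed_of_closure_subset fun x hx => ?_
  rw [Set.mem_ofPred_eq, Metric.tendsto_nhds]
  intro ε hε
  obtain ⟨y, hy, hxy⟩ := Metric.mem_closure_iff.1 hx (ε / 3) (by positivity)
  filter_upwards [Metric.tendsto_nhds.1 hy (ε / 3) (by positivity)] with i hi
  rw [dist_eq_norm] at hi hxy ⊢
  have h1 : ‖u i * (x - y)‖ ≤ ‖x - y‖ :=
    (norm_mul_le _ _).trans (mul_le_of_le_one_left (norm_nonneg _) (hu i))
  calc ‖u i * x - x‖ = ‖u i * (x - y) + (u i * y - y) - (x - y)‖ := by congr 1; noncomm_ring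
    _ ≤ ‖u i * (x - y)‖ + ‖u i * y - y‖ + ‖x - y‖ :=
      (norm_sub_le _ _).trans (add_le_add_left (norm_add_le _ _) _)
    _ < ε := by linarith

theorem subset_generatedCStar (A : NonUnitalSubalgebra ℂ B) {a : B} (ha : a ∈ A) :
    a ∈ generatedCStar A :=
  NonUnitalStarSubalgebra.le_topologicalClosure _
    (NonUnitalStarAlgebra.subset_adjoin ℂ (A : Set B) ha)

theorem isClosed_generatedCStar (A : NonUnitalSubalgebra ℂ B) :
    IsClosed (generatedCStar A : Set B) :=
  NonUnitalStarSubalgebra.isClosed_topologicalClosure _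

end Generated

/-! ### Nearly positive approximate identities and norm estimates -/

section Approximation

variable {B : Type*} [CStarAlgebra B] [PartialOrder B] [StarOrderedRing B]

theorem star_mul_self_le_one {u : B} (hu : ‖u‖ ≤ 1) : star u * u ≤ 1 := by
  rw [← CStarAlgebra.norm_le_one_iff_of_nonneg _ (star_mul_self_nonneg u),
    CStarRing.norm_star_mul_self]
  nlinarith [norm_nonneg u]

/-- Expand `(x - u x)* (x - u x)` and bound `x* u* u x` by `x* x`. This turns a right approximate
identity for `star x` into a left one for `x`, which is how adjoints of elements of `A` are reached.
-/
theorem norm_sub_mul_sq_le {u : B} (hu : ‖u‖ ≤ 1) (x : B) :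
    ‖x - u * x‖ ^ 2 ≤ 2 * ‖x‖ * ‖star x - star x * u‖ := by
  have hN : star (x - u * x) * (x - u * x) ≤
      (star x - star x * u) * x + star ((star x - star x * u) * x) := by
    rw [← sub_nonneg]
    have h : 0 ≤ star x * (1 - star u * u) * x :=
      star_left_conjugate_nonneg (sub_nonneg.2 (star_mul_self_le_one hu)) x
    convert h using 1
    simp only [star_sub, star_mul, star_star]
    noncomm_ring
  have h := CStarAlgebra.norm_le_norm_of_nonneg_of_le (star_mul_self_nonneg _) hN
  rw [CStarRing.norm_star_mul_self] at h
  have h1 := norm_add_le ((star x - star x * u) * x) (star ((star x - star x * u) * x))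
  rw [norm_star] at h1
  have h2 := norm_mul_le (star x - star x * u) x
  nlinarith

theorem tendsto_mul_of_tendsto_star_mul {ι : Type*} {l : Filter ι} {u : ι → B}
    (hu : ∀ i, ‖u i‖ ≤ 1) {x : B} (h : Tendsto (fun i => star x * u i) l (𝓝 (star x))) :
    Tendsto (fun i => u i * x) l (𝓝 x) := by
  rw [tendsto_iff_norm_sub_tendsto_zero] at h ⊢
  have h1 : Tendsto (fun i => Real.sqrt (2 * ‖x‖ * ‖star x * u i - star x‖)) l (𝓝 0) := by
    simpa using (h.const_mul (2 * ‖x‖)).sqrt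
  refine squeeze_zero (fun _ => norm_nonneg _) (fun i => Real.le_sqrt_of_sq_le ?_) h1
  rw [norm_sub_rev, norm_sub_rev (star x * u i)]
  exact norm_sub_mul_sq_le (hu i) x

theorem tendsto_star_mul_of_tendsto_mul {ι : Type*} {l : Filter ι} {u : ι → B}
    (hu : ∀ i, ‖u i‖ ≤ 1) {x : B} (h : Tendsto (fun i => u i * x) l (𝓝 x)) :
    Tendsto (fun i => star (u i) * x) l (𝓝 x) := by
  refine tendsto_mul_of_tendsto_star_mul (fun i => (norm_star (u i)).trans_le (hu i)) ?_
  simpa using h.star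

/-- A contractive approximate identity of `A` is a left approximate identity of the C*-algebra
generated by `A`. -/
theorem IsCai.tendsto_mul {ι : Type*} [Preorder ι] {A : NonUnitalSubalgebra ℂ B} {u : ι → B}
    (hu : IsCai A u) {c : B} (hc : c ∈ generatedCStar A) :
    Tendsto (fun i => u i * c) atTop (𝓝 c) := by
  refine closure_minimal (fun x hx => ?_) (isClosed_setOf_tendsto_mul hu.norm_le) hc
  suffices h : Tendsto (fun i => u i * x) atTop (𝓝 x) ∧
      Tendsto (fun i => u i * star x) atTop (𝓝 (star x)) from h.1
  induction hx using NonUnitalStarAlgebra.adjoin_induction with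
  | mem x hx =>
    refine ⟨hu.left x hx, tendsto_mul_of_tendsto_star_mul hu.norm_le ?_⟩
    simpa using hu.right x hx
  | add x y _ _ hx hy =>
    simp only [mul_add, star_add]
    exact ⟨hx.1.add hy.1, hx.2.add hy.2⟩
  | zero => simp [tendsto_const_nhds]
  | mul x y _ _ hx hy =>
    simp only [star_mul, ← mul_assoc]
    exact ⟨hx.1.mul_const y, hy.2.mul_const _⟩
  | smul r x _ hx =>
    simp only [star_smul, mul_smul_comm]
    exact ⟨hx.1.const_smul r, hx.2.const_smul _⟩
  | star x _ hx => exact ⟨hx.2, by simpa using hx.1⟩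

/-- Sums of far out elements of a contractive approximate identity are nearly positive. -/
theorem IsCai.exists_sum {ι : Type*} [Preorder ι] [IsDirectedOrder ι] [Nonempty ι]
    {A : NonUnitalSubalgebra ℂ B} {u : ι → B} (hu : IsCai A u) (F : Finset B)
    (hF : ∀ c ∈ F, c ∈ generatedCStar A) {δ : ℝ} (hδ : 0 < δ) (n : ℕ) :
    ∃ v ∈ A, ∃ w ∈ generatedCStar A, ‖v‖ ≤ n ∧ 0 ≤ w ∧ w ≤ (n : B) ∧ ‖v - w‖ ^ 2 ≤ 5 * n ∧
      ∀ c ∈ F, ‖n * c - w * c‖ ≤ n * δ := by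
  induction n with
  | zero => exact ⟨0, zero_mem _, 0, zero_mem _, by simp⟩
  | succ n ih =>
    obtain ⟨v, hvA, w, hwC, hv, hw0, hw1, hvw, hc⟩ := ih
    have hY : v - w ∈ generatedCStar A := sub_mem (subset_generatedCStar A hvA) hwC
    have e1 : ∀ᶠ i in atTop, ‖u i * (v - w) - (v - w)‖ < 1 / 2 := by
      simpa [dist_eq_norm] using
        Metric.tendsto_nhds.1 (hu.tendsto_mul hY) (1 / 2) (by norm_num)
    have e2 : ∀ᶠ i in atTop, ∀ c ∈ F, ‖u i * c - c‖ < δ / 2 := by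
      rw [Filter.eventually_all_finset]
      intro c hcF
      simpa only [dist_eq_norm] using
        Metric.tendsto_nhds.1 (hu.tendsto_mul (hF c hcF)) (δ / 2) (by positivity)
    have e3 : ∀ᶠ i in atTop, ∀ c ∈ F, ‖star (u i) * c - c‖ < δ / 2 := by
      rw [Filter.eventually_all_finset]
      intro c hcF
      simpa only [dist_eq_norm] using
        Metric.tendsto_nhds.1 (tendsto_star_mul_of_tendsto_mul hu.norm_le
          (hu.tendsto_mul (hF c hcF))) (δ / 2) (by positivity)
    obtain ⟨i, h1, h2, h3⟩ := (e1.and (e2.and e3)).exists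
    have hui := hu.norm_le i
    have huA := hu.mem i
    have huC := subset_generatedCStar A huA
    generalize u i = a at *
    have hsa : ‖star a‖ ≤ 1 := (norm_star a).trans_le hui
    have hay (y : B) : ‖star a * y‖ ≤ ‖y‖ :=
      (norm_mul_le _ _).trans (mul_le_of_le_one_left (norm_nonneg _) hsa)
    -- `v` is a sum of cai elements `u i` and `w` the sum of the corresponding `star (u i) * u i`.
    refine ⟨v + a, add_mem hvA huA, w + star a * a, add_mem hwC (mul_mem (star_mem huC) huC),
      ?_, add_nonneg hw0 (star_mul_self_nonneg a), ?_, ?_, fun c hcF => ?_⟩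
    · push_cast
      exact (norm_add_le _ _).trans (add_le_add hv hui)
    · push_cast
      exact add_le_add hw1 (star_mul_self_le_one hui)
    · set Y := v - w with hYdef
      set y := a - star a * a with hy
      have hYy : v + a - (w + star a * a) = Y + y := by rw [hYdef, hy]; abel
      have hy2 : ‖y‖ ≤ 2 := by
        have := norm_sub_le a (star a * a)
        have := hay a
        linarith
      -- The new term is almost orthogonal to the old difference, since `a` nearly fixes `Y`. So the
      -- squared norm grows by at most `‖y‖² + 2 · (1/2) ≤ 5`.
      have hcross : ‖star y * Y‖ ≤ 1 / 2 := by
        have : star y * Y = star a * (Y - a * Y) := by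
          rw [hy]; simp only [star_sub, star_mul, star_star]; noncomm_ring
        rw [this]
        refine (hay _).trans ?_
        rw [norm_sub_rev]
        exact h1.le
      rw [hYy, sq, ← CStarRing.norm_star_mul_self]
      have hexp : star (Y + y) * (Y + y) =
          star Y * Y + star y * y + (star y * Y + star (star y * Y)) := by
        simp only [star_add, star_mul, star_star]; noncomm_ring
      rw [hexp]
      have n1 := norm_add_le (star Y * Y + star y * y) (star y * Y + star (star y * Y))
      have n2 := norm_add_le (star Y * Y) (star y * y)
      have n3 := norm_add_le (star y * Y) (star (star y * Y))
      rw [norm_star] at n3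
      rw [CStarRing.norm_star_mul_self, CStarRing.norm_star_mul_self] at n2
      push_cast
      nlinarith [norm_nonneg y]
    · have hexp : ((n + 1 : ℕ) : B) * c - (w + star a * a) * c =
          (n * c - w * c) - (star a * c - c) - star a * (a * c - c) := by
        push_cast; noncomm_ring
      rw [hexp]
      have n1 := norm_sub_le ((n * c - w * c) - (star a * c - c)) (star a * (a * c - c))
      have n2 := norm_sub_le (n * c - w * c) (star a * c - c)
      have := hay (a * c - c)
      have := hc c hcF
      have := h2 c hcF
      have := h3 c hcF
      push_cast
      linarith

/-- An operator algebra with a contractive approximate identity contains nearly positive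
contractions that act as approximate left identities. -/
theorem IsCai.exists_nearly_positive {ι : Type*} [Preorder ι] [IsDirectedOrder ι] [Nonempty ι]
    {A : NonUnitalSubalgebra ℂ B} {u : ι → B} (hu : IsCai A u) (F : Finset B)
    (hF : ∀ c ∈ F, c ∈ generatedCStar A) {δ : ℝ} (hδ : 0 < δ) :
    ∃ v ∈ A, ∃ w : B, ‖v‖ ≤ 1 ∧ 0 ≤ w ∧ w ≤ 1 ∧ ‖v - w‖ ≤ δ ∧
      ∀ c ∈ F, ‖c - w * c‖ ≤ δ := by
  -- Averaging `n` terms brings the difference down to `√(5n) / n = √(5/n)`, which is below `δ`.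
  obtain ⟨n, hn⟩ := exists_nat_gt (5 / δ ^ 2)
  have hn0 : (0 : ℝ) < n := lt_of_le_of_lt (by positivity) hn
  obtain ⟨v, hvA, w, -, hv, hw0, hw1, hvw, hc⟩ := hu.exists_sum F hF hδ n
  have hr : ‖(n : ℝ)⁻¹‖ = (n : ℝ)⁻¹ := by simp
  have hnat (c : B) : (n : ℝ)⁻¹ • ((n : B) * c) = c := by
    rw [← nsmul_eq_mul, ← Nat.cast_smul_eq_nsmul ℝ, smul_smul, inv_mul_cancel₀ hn0.ne', one_smul]
  refine ⟨((n : ℝ)⁻¹ : ℂ) • v, A.smul_mem _ hvA, (n : ℝ)⁻¹ • w, ?_, ?_, ?_, ?_, fun c hcF => ?_⟩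
  · rw [norm_smul]
    simp only [norm_inv, Complex.norm_real, Real.norm_natCast]
    rw [inv_mul_le_iff₀ hn0]
    simpa using hv
  · exact smul_nonneg (by positivity) hw0
  · have := smul_le_smul_of_nonneg_left hw1 (inv_nonneg.2 hn0.le)
    have h1 := hnat 1
    rw [mul_one] at h1
    rwa [h1] at this
  · have : ((n : ℝ)⁻¹ : ℂ) • v - (n : ℝ)⁻¹ • w = (n : ℝ)⁻¹ • (v - w) := by
      rw [smul_sub, ← Complex.coe_smul (n : ℝ)⁻¹ v]; push_cast; rfl
    rw [this, norm_smul, hr, inv_mul_le_iff₀ hn0]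
    refine le_of_sq_le_sq ?_ (by positivity)
    rw [div_lt_iff₀ (by positivity)] at hn
    nlinarith
  · have : c - (n : ℝ)⁻¹ • w * c = (n : ℝ)⁻¹ • (n * c - w * c) := by
      rw [smul_sub, hnat, smul_mul_assoc]
    rw [this, norm_smul, hr, inv_mul_le_iff₀ hn0]
    exact hc c hcF

/-- If `w` is a positive contraction that nearly fixes `c`, then `α + c` and `t (1 - w)` hardly
overlap. -/
theorem norm_add_smul_one_sub_sq_le {α t δ : ℝ} (hα : 0 ≤ α) (ht : 0 ≤ t) {c w : B}
    (hw0 : 0 ≤ w) (hw1 : w ≤ 1) (h1 : ‖c - w * c‖ ≤ δ) (h2 : ‖star c - w * star c‖ ≤ δ) :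
    ‖α • (1 : B) + c + t • (1 - w)‖ ^ 2 ≤
      max (‖α • (1 : B) + c‖ ^ 2) ((α + t) ^ 2) + (2 * t + 4 * α + 2 * ‖c‖) * δ := by
  set x := α • (1 : B) + c with hx
  set M := max (‖x‖ ^ 2) ((α + t) ^ 2) with hM
  set h := 1 - w with hh
  have hws : star w = w := (IsSelfAdjoint.of_nonneg hw0).star_eq
  have hhs : star h = h := by rw [hh]; simp [hws]
  have hh0 : 0 ≤ h := sub_nonneg.2 hw1
  have hwn : ‖w‖ ≤ 1 := (CStarAlgebra.norm_le_one_iff_of_nonneg w hw0).2 hw1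
  have hhn : h * h ≤ h := by
    have : 0 ≤ h * w := by
      have e : Commute h w := by rw [hh]; simp [Commute, SemiconjBy, sub_mul, mul_sub]
      exact e.mul_nonneg hh0 hw0
    have e : h - h * h = h * w := by rw [hh]; noncomm_ring
    rwa [← sub_nonneg, e]
  have hww : w * w ≤ w := by
    have : 0 ≤ h * w := by
      have e : Commute h w := by rw [hh]; simp [Commute, SemiconjBy, sub_mul, mul_sub]
      exact e.mul_nonneg hh0 hw0
    have e : w - w * w = h * w := by rw [hh]; noncomm_ring
    rwa [← sub_nonneg, e]
  have hhc : ‖h * c‖ ≤ δ := by rw [hh, sub_mul, one_mul]; exact h1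
  have hhc' : ‖h * star c‖ ≤ δ := by rw [hh, sub_mul, one_mul]; exact h2
  set m := M - α ^ 2 with hm
  have hm1 : 2 * α * t + t ^ 2 ≤ m := by
    have := le_max_right (‖x‖ ^ 2) ((α + t) ^ 2)
    rw [hm, hM]; nlinarith
  have hm0 : 0 ≤ m := le_trans (by positivity) hm1
  set k := α • c + α • star c + star c * c with hk
  have hxk : star x * x = α ^ 2 • (1 : B) + k := by
    rw [hx, hk]
    simp only [star_add, star_smul, star_one, star_trivial, add_mul, mul_add, smul_mul_assoc,
      mul_smul_comm, one_mul, mul_one]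
    module
  have hkm : k ≤ m • (1 : B) := by
    have h3 : star x * x ≤ algebraMap ℝ B (‖x‖ ^ 2) := CStarAlgebra.star_mul_le_algebraMap_norm_sq
    rw [Algebra.algebraMap_eq_smul_one, hxk] at h3
    have h4 : (‖x‖ ^ 2) • (1 : B) ≤ M • (1 : B) :=
      smul_le_smul_of_nonneg_right (le_max_left _ _) zero_le_one
    have h5 := h3.trans h4
    rw [hm, sub_smul]
    exact le_sub_iff_add_le'.2 h5
  have hwk : w * k * w ≤ m • w := by
    have h3 := conjugate_le_conjugate_of_nonneg hkm hw0
    refine h3.trans ?_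
    rw [mul_smul_comm, mul_one, smul_mul_assoc]
    exact smul_le_smul_of_nonneg_left hww hm0
  have hks : star k = k := by
    rw [hk]; simp only [star_add, star_smul, star_mul, star_star, star_trivial]; abel
  -- `E` collects every term containing `h * c`, `h * k` or an adjoint. What remains is `α²` plus `w
  -- k w ≤ m w` plus `2αt h + t² h² ≤ m h`, and `w + h = 1` gives the total `α² + m = M`.
  set E := t • (h * c + star (h * c)) + (h * k + w * star (h * k)) with hE
  have hle : star (x + t • h) * (x + t • h) ≤ M • (1 : B) + E := by
    have e : M • (1 : B) + E - star (x + t • h) * (x + t • h) =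
        (m - (2 * α * t + t ^ 2)) • h + (m • w - w * k * w) + t ^ 2 • (h - h * h) := by
      have e1 : star (x + t • h) * (x + t • h) =
          star x * x + t • (h * x + star (h * x)) + t ^ 2 • (h * h) := by
        simp only [star_add, star_smul, star_trivial, star_mul, hhs, add_mul, mul_add,
          smul_mul_assoc, mul_smul_comm]
        module
      have e2 : h * x = α • h + h * c := by
        rw [hx, mul_add, mul_smul_comm, mul_one]
      have e3 : M = m + α ^ 2 := by rw [hm]; ring
      have e4 : k = h * k + w * (k * h) + w * k * w := by
        rw [hh]; noncomm_ring
      have e6 : star (h * k) = k * h := by rw [star_mul, hhs, hks]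
      have e7 : star (h * x) = α • h + star (h * c) := by
        rw [e2, star_add, star_smul, hhs, star_trivial]
      rw [e1, hxk, e7, e2, hE, e6, e3]
      have e8 : h * k + w * (k * h) = k - w * k * w := by
        rw [eq_sub_iff_add_eq]; exact e4.symm
      rw [e8]
      have e9 : (1 : B) = h + w := by rw [hh]; abel
      rw [e9]
      module
    rw [← sub_nonneg, e]
    refine add_nonneg (add_nonneg ?_ (sub_nonneg.2 hwk)) ?_
    · exact smul_nonneg (by linarith) hh0
    · exact smul_nonneg (by positivity) (sub_nonneg.2 hhn)
  have hδ : 0 ≤ δ := (norm_nonneg _).trans h1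
  have hhk : ‖h * k‖ ≤ (2 * α + ‖c‖) * δ := by
    have e : h * k = α • (h * c) + α • (h * star c) + h * star c * c := by
      rw [hk]; simp only [mul_add, mul_smul_comm, mul_assoc]
    rw [e]
    have n1 := norm_add_le (α • (h * c) + α • (h * star c)) (h * star c * c)
    have n2 := norm_add_le (α • (h * c)) (α • (h * star c))
    rw [norm_smul, norm_smul, Real.norm_of_nonneg hα] at n2
    have n3 : ‖h * star c * c‖ ≤ δ * ‖c‖ :=
      (norm_mul_le _ _).trans (mul_le_mul_of_nonneg_right hhc' (norm_nonneg _))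
    nlinarith
  have hEn : ‖E‖ ≤ (2 * t + 4 * α + 2 * ‖c‖) * δ := by
    have n1 := norm_add_le (t • (h * c + star (h * c))) (h * k + w * star (h * k))
    have n2 := norm_add_le (h * k) (w * star (h * k))
    have n3 := norm_add_le (h * c) (star (h * c))
    rw [norm_star] at n3
    have n4 : ‖w * star (h * k)‖ ≤ ‖h * k‖ := by
      refine (norm_mul_le _ _).trans ?_
      rw [norm_star]
      exact mul_le_of_le_one_left (norm_nonneg _) hwn
    rw [norm_smul, Real.norm_of_nonneg ht] at n1
    rw [← hE] at n1
    nlinarith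
  have hfin := CStarAlgebra.norm_le_norm_of_nonneg_of_le (star_mul_self_nonneg _) hle
  rw [CStarRing.norm_star_mul_self, ← sq] at hfin
  have hM0 : 0 ≤ M := le_trans (sq_nonneg _) (le_max_left _ _)
  have hone : ‖M • (1 : B)‖ ≤ M := by
    rw [norm_smul, Real.norm_of_nonneg hM0]
    refine mul_le_of_le_one_right hM0 ?_
    exact (CStarAlgebra.norm_le_one_iff_of_nonneg (1 : B) zero_le_one).2 le_rfl
  exact hfin.trans ((norm_add_le _ _).trans (add_le_add hone hEn))

end Approximation

/-! ### The ideal of codimension one -/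

section Codimension

variable {B : Type*} [CStarAlgebra B] {C : NonUnitalStarSubalgebra ℂ B}

theorem eq_zero_of_smul_one_mem (h1 : (1 : B) ∉ C) {z : ℂ} (hz : z • (1 : B) ∈ C) : z = 0 := by
  by_contra h
  have := SMulMemClass.smul_mem z⁻¹ hz
  rw [smul_smul, inv_mul_cancel₀ h, one_smul] at this
  exact h1 this

theorem mul_mem_of_mem_left (hC : ∀ b : B, ∃ z : ℂ, ∃ c ∈ C, b = z • (1 : B) + c) {c : B}
    (hc : c ∈ C) (b : B) : c * b ∈ C := by
  obtain ⟨z, c', hc', rfl⟩ := hC b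
  rw [mul_add, mul_smul_comm, mul_one]
  exact add_mem (SMulMemClass.smul_mem z hc) (mul_mem hc hc')

theorem mul_mem_of_mem_right (hC : ∀ b : B, ∃ z : ℂ, ∃ c ∈ C, b = z • (1 : B) + c) {c : B}
    (hc : c ∈ C) (b : B) : b * c ∈ C := by
  obtain ⟨z, c', hc', rfl⟩ := hC b
  rw [add_mul, smul_mul_assoc, one_mul]
  exact add_mem (SMulMemClass.smul_mem z hc) (mul_mem hc' hc)

/-- The quotient map of `B` by an ideal of codimension one. -/
theorem exists_dual_eq_one (hC : ∀ b : B, ∃ z : ℂ, ∃ c ∈ C, b = z • (1 : B) + c)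
    (hcl : IsClosed (C : Set B)) (h1 : (1 : B) ∉ C) :
    ∃ χ : StrongDual ℂ B, χ 1 = 1 ∧ ∀ c ∈ C, χ c = 0 := by
  obtain ⟨f, hf, hfC⟩ := Submodule.exists_dual_map_eq_bot_of_notMem
    (p := C.toNonUnitalSubalgebra.toSubmodule) (x := (1 : B)) h1 inferInstance
  have hf0 : ∀ c ∈ C, f c = 0 := fun c hc => by
    have : f c ∈ Submodule.map f C.toNonUnitalSubalgebra.toSubmodule := ⟨c, hc, rfl⟩
    rwa [hfC, Submodule.mem_bot] at this
  have hker : (LinearMap.ker f : Set B) = C := by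
    ext b
    simp only [SetLike.mem_coe, LinearMap.mem_ker]
    refine ⟨fun hb => ?_, hf0 b⟩
    obtain ⟨z, c, hc, rfl⟩ := hC b
    rw [map_add, hf0 c hc, map_smul, add_zero, smul_eq_mul] at hb
    rw [(mul_eq_zero.1 hb).resolve_right hf]
    simpa using hc
  have hcont : Continuous f := f.continuous_of_isClosed_ker (hker ▸ hcl)
  refine ⟨(f 1)⁻¹ • ⟨f, hcont⟩, ?_, fun c hc => ?_⟩
  · simpa using inv_mul_cancel₀ hf
  · simp [hf0 c hc]

variable [PartialOrder B] [StarOrderedRing B]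

/-- For `b = y* y` the scalar part is `|z|²`, where `z` is the scalar part of `y`. Consequently the
quotient character is positive. -/
theorem exists_nonneg_smul_add (hC : ∀ b : B, ∃ z : ℂ, ∃ c ∈ C, b = z • (1 : B) + c) {b : B}
    (hb : 0 ≤ b) : ∃ r : ℝ, 0 ≤ r ∧ ∃ c ∈ C, b = r • (1 : B) + c := by
  obtain ⟨y, rfl⟩ := CStarAlgebra.nonneg_iff_eq_star_mul_self.1 hb
  obtain ⟨z, c, hc, rfl⟩ := hC y
  refine ⟨‖z‖ ^ 2, by positivity, star z • c + z • star c + star c * c, ?_, ?_⟩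
  · exact add_mem (add_mem (SMulMemClass.smul_mem _ hc) (SMulMemClass.smul_mem _ (star_mem hc)))
      (mul_mem (star_mem hc) hc)
  · have : ‖z‖ ^ 2 • (1 : B) = (star z * z) • (1 : B) := by
      rw [← Complex.coe_smul, Complex.ofReal_pow, ← Complex.conj_mul']
      rfl
    rw [this]
    simp only [star_add, star_smul, star_one, add_mul, mul_add, smul_mul_assoc, mul_smul_comm,
      one_mul, mul_one]
    module

end Codimension

/-! ### Peak interpolation -/

section Interpolation

variable {B : Type*} [CStarAlgebra B] [PartialOrder B] [StarOrderedRing B]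
  {ι : Type*} [Preorder ι] [IsDirectedOrder ι] [Nonempty ι] {A : NonUnitalSubalgebra ℂ B}
  {u : ι → B}

theorem exists_pos_mul_le {K η : ℝ} (hK : 0 ≤ K) (hη : 0 < η) : ∃ δ > 0, K * δ ≤ η := by
  refine ⟨η / (K + 1), by positivity, ?_⟩
  rw [mul_div_assoc', div_le_iff₀ (by positivity)]
  nlinarith

/-- Adding a multiple of `(1 - v) f`, for a suitable contraction `v` in `A`, changes the norm only
as much as it changes it modulo the C*-algebra generated by `A`. -/
theorem IsCai.exists_norm_add_lt (hu : IsCai A u) {α t lam R R' : ℝ} {c k : B}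
    (hc : c ∈ generatedCStar A) (hk : k ∈ generatedCStar A) (hα : 0 ≤ α) (ht : 0 ≤ t)
    (hlam : 0 ≤ lam) (hR : 0 ≤ R) (hRR' : R < R') (hx : ‖α • (1 : B) + c‖ ≤ R)
    (hαR : α + t * lam ≤ R) :
    ∃ v ∈ A, ‖v‖ ≤ 1 ∧
      ‖α • (1 : B) + c + t • ((1 - v) * (lam • (1 : B) + k))‖ < R' := by
  classical
  -- Half of the gap `R' - R` pays for the overlap estimate with `w`, a quarter for replacing `(1 -
  -- v) (lam • 1 + k)` by `lam • (1 - w)`.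
  set r := (R + R') / 2 with hr
  obtain ⟨δ₁, hδ₁, h₁⟩ := exists_pos_mul_le (K := 2 * (t * lam) + 4 * α + 2 * ‖c‖)
    (η := r ^ 2 - R ^ 2) (by positivity) (by rw [hr]; nlinarith)
  obtain ⟨δ₂, hδ₂, h₂⟩ := exists_pos_mul_le (K := t * (lam + 1 + ‖k‖))
    (η := (R' - R) / 4) (by positivity) (by linarith)
  have hδ : 0 < min δ₁ δ₂ := lt_min hδ₁ hδ₂
  obtain ⟨v, hvA, w, hv, hw0, hw1, hvw, hF⟩ := hu.exists_nearly_positive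
    ({c, star c, k} : Finset B) (by
      intro x hx
      simp only [Finset.mem_insert, Finset.mem_singleton] at hx
      rcases hx with rfl | rfl | rfl
      exacts [hc, star_mem hc, hk]) hδ
  refine ⟨v, hvA, hv, ?_⟩
  have hmain := norm_add_smul_one_sub_sq_le hα (mul_nonneg ht hlam) hw0 hw1
    ((hF c (by simp)).trans (min_le_left δ₁ δ₂)) ((hF (star c) (by simp)).trans (min_le_left _ _))
  have hfk := (hF k (by simp)).trans (min_le_right _ _)
  have hvw' := hvw.trans (min_le_right _ _)
  have hmax : max (‖α • (1 : B) + c‖ ^ 2) ((α + t * lam) ^ 2) ≤ R ^ 2 :=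
    max_le (pow_le_pow_left₀ (norm_nonneg _) hx 2) (pow_le_pow_left₀ (by positivity) hαR 2)
  have hmain' : ‖α • (1 : B) + c + (t * lam) • (1 - w)‖ ≤ r :=
    le_of_sq_le_sq (by linarith) (by rw [hr]; linarith)
  have hexp : α • (1 : B) + c + t • ((1 - v) * (lam • (1 : B) + k)) =
      (α • (1 : B) + c + (t * lam) • (1 - w)) +
        t • (-(lam • (v - w)) + (k - w * k) - (v - w) * k) := by
    simp only [mul_add, sub_mul, mul_smul_comm, mul_one, one_mul]
    module
  rw [hexp]
  refine (norm_add_le _ _).trans_lt ?_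
  have n1 := norm_sub_le (-(lam • (v - w)) + (k - w * k)) ((v - w) * k)
  have n2 := norm_add_le (-(lam • (v - w))) (k - w * k)
  have n3 := norm_mul_le (v - w) k
  rw [norm_neg, norm_smul, Real.norm_of_nonneg hlam] at n2
  have n4 : ‖-(lam • (v - w)) + (k - w * k) - (v - w) * k‖ ≤ (lam + 1 + ‖k‖) * δ₂ := by
    nlinarith [norm_nonneg k, norm_nonneg (v - w)]
  rw [norm_smul, Real.norm_of_nonneg ht]
  have n5 := mul_le_mul_of_nonneg_left n4 ht
  rw [hr] at hmain'
  linarith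

/-- The partial sums of a peak interpolation series. -/
theorem IsCai.exists_seq (hu : IsCai A u)
    (hC : ∀ b : B, ∃ z : ℂ, ∃ c ∈ generatedCStar A, b = z • (1 : B) + c) {lam : ℝ} {k : B}
    (hk : k ∈ generatedCStar A) (hlam : 0 ≤ lam) (hlam1 : lam ≤ 1) :
    ∃ p : ℕ → B, ∀ n, p n ∈ A ∧
      ‖((1 - (1 / 2 : ℝ) ^ n) • (1 : B) - p n) * (lam • (1 : B) + k)‖ ≤ 1 - (1 / 2) ^ (n + 1) ∧
      ‖p (n + 1) - p n‖ ≤ (1 / 2) ^ (n + 1) := by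
  let Q (n : ℕ) (b : B) : Prop := b ∈ A ∧
    ‖((1 - (1 / 2 : ℝ) ^ n) • (1 : B) - b) * (lam • (1 : B) + k)‖ ≤ 1 - (1 / 2) ^ (n + 1)
  have step : ∀ (n : ℕ) (b : {b // Q n b}), ∃ b' : {b' // Q (n + 1) b'},
      ‖(b' : B) - b‖ ≤ (1 / 2) ^ (n + 1) := by
    rintro n ⟨b, hbA, hb⟩
    set f := lam • (1 : B) + k with hf
    set s : ℝ := (1 / 2 : ℝ) ^ n with hs
    have hs0 : 0 < s := by positivity
    have hs1 : s ≤ 1 := pow_le_one₀ (by norm_num) (by norm_num)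
    have hsucc : (1 / 2 : ℝ) ^ (n + 1) = s / 2 := by rw [pow_succ]; ring
    have hsucc' : (1 / 2 : ℝ) ^ (n + 1 + 1) = s / 4 := by rw [pow_succ, pow_succ]; ring
    rw [hsucc] at hb
    have hx : ((1 - s) • (1 : B) - b) * f =
        ((1 - s) * lam) • (1 : B) + ((1 - s) • k - b * f) := by
      rw [sub_mul, smul_mul_assoc, one_mul, hf]
      module
    have hcC : (1 - s) • k - b * f ∈ generatedCStar A := by
      refine sub_mem ?_ (mul_mem_of_mem_left hC (subset_generatedCStar A hbA) f)
      rw [← Complex.coe_smul]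
      exact SMulMemClass.smul_mem _ hk
    rw [hx] at hb
    -- The new scalar part is `(1 - s) lam + (s / 2) lam = (1 - s / 2) lam`, at most `R` because
    -- `lam ≤ 1`.
    obtain ⟨v, hvA, hv, hlt⟩ := hu.exists_norm_add_lt (t := s / 2) (R := 1 - s / 2)
      (R' := 1 - s / 4) hcC hk (mul_nonneg (by linarith) hlam) (by positivity) hlam
      (by linarith) (by linarith) hb (by nlinarith)
    rw [← hx, ← hf] at hlt
    have hsv : (s / 2) • v ∈ A := by
      rw [← Complex.coe_smul]
      exact A.smul_mem _ hvA
    refine ⟨⟨b + (s / 2) • v, add_mem hbA hsv, ?_⟩, ?_⟩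
    · rw [hsucc, hsucc', ← hf]
      have : ((1 - s / 2) • (1 : B) - (b + (s / 2) • v)) * f =
          ((1 - s) • (1 : B) - b) * f + (s / 2) • ((1 - v) * f) := by
        simp only [sub_mul, add_mul, smul_mul_assoc, one_mul]
        module
      rw [this]
      exact hlt.le
    · simp only [add_sub_cancel_left, norm_smul, hsucc]
      rw [Real.norm_of_nonneg (by positivity)]
      exact mul_le_of_le_one_right (by positivity) hv
  choose F hF using step
  let p : (n : ℕ) → {b // Q n b} := fun n =>
    Nat.rec ⟨0, zero_mem A, by norm_num⟩ (fun n b => F n b) n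
  refine ⟨fun n => (p n).1, fun n => ⟨(p n).2.1, (p n).2.2, ?_⟩⟩
  exact hF n (p n)

theorem IsCai.exists_norm_one_add_mul_le (hu : IsCai A u) (hA : IsClosed (A : Set B))
    (hC : ∀ b : B, ∃ z : ℂ, ∃ c ∈ generatedCStar A, b = z • (1 : B) + c) {lam : ℝ} {k : B}
    (hk : k ∈ generatedCStar A) (hlam : 0 ≤ lam) (hlam1 : lam ≤ 1) :
    ∃ a ∈ A, ‖(1 + a) * (lam • (1 : B) + k)‖ ≤ 1 := by
  obtain ⟨p, hp⟩ := hu.exists_seq hC hk hlam hlam1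
  have hcauchy : CauchySeq p := by
    refine cauchySeq_of_le_geometric (1 / 2) (1 / 2) (by norm_num) fun n => ?_
    rw [dist_comm, dist_eq_norm]
    refine (hp n).2.2.trans_eq ?_
    rw [pow_succ, mul_comm]
  obtain ⟨a, ha⟩ := cauchySeq_tendsto_of_complete hcauchy
  have haA : a ∈ A := hA.mem_of_tendsto ha (Eventually.of_forall fun n => (hp n).1)
  refine ⟨-a, neg_mem haA, ?_⟩
  have hpow : Tendsto (fun n : ℕ => (1 - (1 / 2 : ℝ) ^ n)) atTop (𝓝 1) := by
    simpa using (tendsto_pow_atTop_nhds_zero_of_lt_one (r := (1 / 2 : ℝ)) (by norm_num)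
      (by norm_num)).const_sub 1
  have hlim : Tendsto (fun n => ((1 - (1 / 2 : ℝ) ^ n) • (1 : B) - p n) * (lam • (1 : B) + k))
      atTop (𝓝 ((1 + -a) * (lam • (1 : B) + k))) := by
    have := ((hpow.smul_const (1 : B)).sub ha).mul_const (lam • (1 : B) + k)
    simpa [sub_eq_add_neg] using this
  refine le_of_tendsto hlim.norm (Eventually.of_forall fun n => (hp n).2.1.trans ?_)
  have : (0 : ℝ) ≤ (1 / 2) ^ (n + 1) := by positivity
  linarith

theorem IsCai.exists_star_mul_self_le (hu : IsCai A u) (hA : IsClosed (A : Set B))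
    (hC : ∀ b : B, ∃ z : ℂ, ∃ c ∈ generatedCStar A, b = z • (1 : B) + c)
    (h1 : (1 : B) ∉ generatedCStar A) {d c : B} (hd : 0 ≤ d) (hdu : IsUnit d) {r : ℝ}
    (hr : 1 ≤ r) (hc : c ∈ generatedCStar A) (hdc : d = r • (1 : B) + c) :
    ∃ a ∈ A, star (1 + a) * (1 + a) ≤ d := by
  obtain ⟨s, hs⟩ := (CFC.isUnit_sqrt_iff d hd).2 hdu
  have hs0 : (0 : B) ≤ s := hs ▸ CFC.sqrt_nonneg d
  have hss : (s : B) * s = d := by rw [hs]; exact CFC.sqrt_mul_sqrt_self d hd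
  have hf0 : (0 : B) ≤ (s⁻¹ : Bˣ) := CFC.inv_nonneg_of_nonneg s hs0
  obtain ⟨lam, hlam, k, hk, hfk⟩ := exists_nonneg_smul_add hC hf0
  -- Compare scalar parts modulo `C` in `f² d = 1`, where `f = s⁻¹`.
  have hlam2 : lam * lam * r = 1 := by
    have e : ((s⁻¹ : Bˣ) : B) * (s⁻¹ : Bˣ) * d = 1 := by
      rw [← hss, mul_assoc, ← mul_assoc _ (s : B), Units.inv_mul, one_mul, Units.inv_mul]
    have hmem : (1 - lam * lam * r) • (1 : B) ∈ generatedCStar A := by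
      have e2 : (1 - lam * lam * r) • (1 : B) = k * ((s⁻¹ : Bˣ) * d) + lam • (k * d) +
          (lam * lam) • c := by
        have e3 : k * ((s⁻¹ : Bˣ) * d) + lam • (k * d) + (lam * lam) • d = 1 := by
          rw [← e, hfk]
          simp only [mul_add, add_mul, smul_mul_assoc, mul_smul_comm, one_mul, mul_one, mul_assoc]
          module
        have e4 : (lam * lam) • d = (lam * lam * r) • (1 : B) + (lam * lam) • c := by
          rw [hdc]; module
        rw [sub_smul, one_smul, sub_eq_iff_eq_add]
        refine e3.symm.trans ?_
        rw [e4]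
        abel
      rw [e2, ← Complex.coe_smul, ← Complex.coe_smul]
      exact add_mem (add_mem (mul_mem_of_mem_left hC hk _)
        (SMulMemClass.smul_mem _ (mul_mem_of_mem_left hC hk _))) (SMulMemClass.smul_mem _ hc)
    rw [← Complex.coe_smul] at hmem
    have := eq_zero_of_smul_one_mem h1 hmem
    rw [Complex.ofReal_eq_zero] at this
    linarith
  obtain ⟨a, haA, ha⟩ := hu.exists_norm_one_add_mul_le hA hC hk hlam (by nlinarith)
  refine ⟨a, haA, ?_⟩
  rw [← hfk] at ha
  have h2 := star_left_conjugate_le_conjugate (star_mul_self_le_one ha) (s : B)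
  have e1 : star (s : B) = s := (IsSelfAdjoint.of_nonneg hs0).star_eq
  have e2 : (1 + a) = (1 + a) * (s⁻¹ : Bˣ) * s := by
    rw [mul_assoc, Units.inv_mul, mul_one]
  have e3 : star (1 + a) * (1 + a) =
      star (s : B) * (star ((1 + a) * (s⁻¹ : Bˣ)) * ((1 + a) * (s⁻¹ : Bˣ))) * s := by
    nth_rewrite 1 [e2]
    nth_rewrite 2 [e2]
    rw [star_mul ((1 + a) * ((s⁻¹ : Bˣ) : B))]
    simp only [mul_assoc]
  rw [e3]
  refine h2.trans_eq ?_
  rw [mul_one, e1, hss]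

end Interpolation

/-! ### The support projection in the bidual -/

section Arens

variable {B : Type*} [CStarAlgebra B] {ι : Type*} [Preorder ι] {u : ι → B} {e : Bidual B}

theorem IsWeakStarLimit.tendsto_apply (he : IsWeakStarLimit u e) (φ : StrongDual ℂ B) :
    Tendsto (fun i => φ (u i)) atTop (𝓝 (e φ)) :=
  ((WeakDual.eval_continuous φ).tendsto (StrongDual.toWeakDual e)).comp he

variable [IsDirectedOrder ι] [Nonempty ι]

theorem IsWeakStarLimit.apply_eq (he : IsWeakStarLimit u e) {φ : StrongDual ℂ B} {z : ℂ}
    (h : Tendsto (fun i => φ (u i)) atTop (𝓝 z)) : e φ = z :=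
  tendsto_nhds_unique (he.tendsto_apply φ) h

/-- In the limit `a * u i → a` becomes `a e = a`, so `a` annihilates `1 - e`. On the other side `u i
* a → a` is used. -/
theorem IsCai.arens_incl_compl {A : NonUnitalSubalgebra ℂ B} (hu : IsCai A u)
    (he : IsWeakStarLimit u e) {a : B} (ha : a ∈ A) :
    arens (incl (1 + a)) (incl 1 - e) = incl 1 - e := by
  ext φ
  have h : e (dualMul φ a) = φ a :=
    he.apply_eq ((φ.continuous.tendsto a).comp (hu.right a ha))
  have h1 : dualMul φ 1 = φ := by ext b; simp [dualMul_apply]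
  simp [arens_apply, bidualMul_apply, h, h1, dualMul_apply, map_add]

theorem IsCai.arens_compl_incl {A : NonUnitalSubalgebra ℂ B} (hu : IsCai A u)
    (he : IsWeakStarLimit u e) {a : B} (ha : a ∈ A) :
    arens (incl 1 - e) (incl (1 + a)) = incl 1 - e := by
  ext φ
  have h1 : bidualMul (incl (1 + a)) φ = φ + bidualMul (incl a) φ := by
    ext b; simp [bidualMul_apply, dualMul_apply]
  have h : e (bidualMul (incl a) φ) = φ a :=
    he.apply_eq ((φ.continuous.tendsto a).comp (hu.left a ha))
  rw [arens_apply, h1]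
  simp [h, bidualMul_apply, dualMul_apply]

end Arens

end OperatorAlgebra

theorem lemma2p1 {B : Type*} [CStarAlgebra B] [PartialOrder B] [StarOrderedRing B]
    (A : NonUnitalSubalgebra ℂ B) (hA : IsClosed (A : Set B))
    (hB : OperatorAlgebra.IsUnitizationOf (OperatorAlgebra.generatedCStar A))
    {ι : Type*} [Preorder ι] [IsDirectedOrder ι] [Nonempty ι]
    (u : ι → B) (hu : OperatorAlgebra.IsCai A u) :
    (∀ e q : OperatorAlgebra.Bidual B, OperatorAlgebra.IsWeakStarLimit u e →
      q = OperatorAlgebra.incl 1 - e →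
      ∀ d : B, 0 ≤ d → IsUnit d →
        OperatorAlgebra.BidualLE q (OperatorAlgebra.incl d) →
        ∃ g ∈ OperatorAlgebra.unitization A,
          OperatorAlgebra.arens (OperatorAlgebra.incl g) q = q ∧
          OperatorAlgebra.arens q (OperatorAlgebra.incl g) = q ∧
          star g * g ≤ d) ∧
    (¬ OperatorAlgebra.IsUnital (A : Set B) →
      ∀ c ∈ OperatorAlgebra.generatedCStar A, 0 ≤ c → ‖c‖ < 1 →
        ∃ a ∈ A, CFC.abs (1 + a) ^ 2 ≤ 1 - c) := by
  have h1A : (1 : B) ∈ OperatorAlgebra.generatedCStar A → (1 : B) ∈ A := fun h =>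
    hA.mem_of_tendsto (by simpa using hu.tendsto_mul h) (Eventually.of_forall hu.mem)
  constructor
  · rintro e q he rfl d hd hdu hqd
    suffices h : ∃ a ∈ A, star (1 + a) * (1 + a) ≤ d by
      obtain ⟨a, haA, had⟩ := h
      exact ⟨1 + a, ⟨1, a, haA, by rw [one_smul]⟩, hu.arens_incl_compl he haA,
        hu.arens_compl_incl he haA, had⟩
    by_cases h1 : (1 : B) ∈ OperatorAlgebra.generatedCStar A
    -- Here `e = 1` and `q = 0`, so `g = 0` is allowed.
    · exact ⟨-1, neg_mem (h1A h1), by simpa using hd⟩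
    obtain ⟨r, hr, c, hc, hdc⟩ := OperatorAlgebra.exists_nonneg_smul_add hB.exists_eq hd
    obtain ⟨χ, hχ1, hχ⟩ := OperatorAlgebra.exists_dual_eq_one hB.exists_eq
      (OperatorAlgebra.isClosed_generatedCStar A) h1
    have hχr (r : ℝ) (c : B) (hc : c ∈ OperatorAlgebra.generatedCStar A) :
        χ (r • (1 : B) + c) = r := by
      rw [← Complex.coe_smul, map_add, map_smul, hχ1, hχ c hc]
      simp
    have hpos : ∀ b : B, 0 ≤ b → 0 ≤ χ b := fun b hb => by
      obtain ⟨r, hr, c, hc, rfl⟩ := OperatorAlgebra.exists_nonneg_smul_add hB.exists_eq hb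
      rw [hχr r c hc]
      exact_mod_cast hr
    have heχ : e χ = 0 := he.apply_eq (by
      simp [hχ _ (OperatorAlgebra.subset_generatedCStar A (hu.mem _))])
    -- The order hypothesis enters only here: `q χ = 1` and `χ d = r`.
    have h1r : (1 : ℂ) ≤ (r : ℂ) := by
      have := hqd χ hpos
      simpa [heχ, hχ1, hdc, -map_add, hχr r c hc] using this
    exact hu.exists_star_mul_self_le hA hB.exists_eq h1 hd hdu (by exact_mod_cast h1r) hc hdc
  · intro hAu c hc hc0 hc1
    simp only [CFC.abs_sq]
    rcases subsingleton_or_nontrivial B with hBs | hBn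
    -- In the zero algebra `‖1‖ = 0`, so `A` counts as nonunital although `1 ∈ A`.
    · exact ⟨0, zero_mem A, (Subsingleton.elim _ _).le⟩
    have h1 : (1 : B) ∉ OperatorAlgebra.generatedCStar A := fun h =>
      hAu ⟨1, h1A h, norm_one, fun a _ => ⟨one_mul a, mul_one a⟩⟩
    refine hu.exists_star_mul_self_le hA hB.exists_eq h1 (r := 1) (c := -c) ?_ ?_ le_rfl
      (neg_mem hc) (by rw [one_smul, sub_eq_add_neg])
    · exact sub_nonneg.2 ((CStarAlgebra.norm_le_one_iff_of_nonneg c hc0).1 hc1.le)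
    · exact (Units.oneSub c hc1).isUnit
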